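/- Let $L$ be Lebesgue measure on $\mathbb C$ and let $L^{2,1}_{\mathcal E}$ be the set of functions $u(z)=e^{-|z|^2/2}f(z)$ with $f$ entire and $\int_{\mathbb C}(1+|z|^2)|u(z)|^2\,dL(z)<\infty$. Put $$\mathcal H(u)=\tfrac14\int_{\mathbb C}|u|^4\,dL,\quad M(u)=\int_{\mathbb C}|u|^2\,dL,\quad P(u)=\int_{\mathbb C}(|z|^2-1)|u(z)|^2\,dL(z),\quad Q(u)=\int_{\mathbb C}z|u(z)|^2\,dL(z),$$ $$B(u)=4\pi\mathcal H(u)+\tfrac14\bigl(M(u)P(u)-|Q(u)|^2\bigr)-\tfrac12M(u)^2 .$$ **Theorem.** (i) For every $u\in L^{2,1}_{\mathcal E}$ these four integrals converge absolutely, $B(cu)=|c|^4B(u)$ for all $c\in\mathbb C$, and $B(u)\ge 0$. (ii) Let $u\in L^{2,1}_{\mathcal E}$, and let $a_n=\int_{\mathbb C}\overline{\phi_n}\,u\,dL$ ($n\ge0$) be its coefficients in the orthonormal system $\phi_n(z)=(\pi n!)^{-1/2}z^ne^{-|z|^2/2}$. Put $$A_{jk}=\frac{a_k\,a_{j-k}}{\sqrt{k!\,(j-k)!}},\qquad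 0\le k\le j .$$ Then $A_{jk}=A_{j,j-k}$ and $$B(u)=\sum_{j=0}^{\infty}\ \sum_{k,\ell=0}^{j}B^{(j)}_{k\ell}\,\overline{A_{jk}}\,A_{j\ell},$$ where the series over $j$ converges absolutely and $B^{(j)}=(B^{(j)}_{k\ell})_{0\le k,\ell\le j}$ is the real matrix with entries $$B^{(j)}_{kk}=\frac{j!}{2^{j+1}}+\frac{(j-4)\,k!\,(j-k)!}{8},\qquad B^{(j)}_{k,k+1}=B^{(j)}_{k+1,k}=\frac{j!}{2^{j+1}}-\frac{(k+1)!\,(j-k)!}{8},$$ and $B^{(j)}_{k\ell}=j!/2^{j+1}$ when $|k-\ell|\ge2$. (iii) For every $j\ge0$ the matrix $B^{(j)}$ is symmetric, and it is positive semidefinite on symmetric vectors: for all $v=(v_0,\dots,v_j)\in\mathbb C^{j+1}$ with $v_k=v_{j-k}$ for $0\le k\le j$, the number $\sum_{k,\ell=0}^{j}B^{(j)}_{k\ell}\,\overline{v_k}\,v_\ell$ is real and non-negative. -/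

import Mathlib

open MeasureTheory

noncomputable section

namespace LLL

/-- The space `L^{2,1}_𝓔`: functions `u(z) = e^{-|z|²/2} f(z)` with `f` entire and
`√(1+|z|²) u(z)` square integrable for the Lebesgue measure of `ℂ`. -/
def L21E : Set (ℂ → ℂ) :=
  {u | (∃ f : ℂ → ℂ, Differentiable ℂ f ∧
          ∀ z, u z = (Real.exp (-‖z‖ ^ 2 / 2) : ℂ) * f z) ∧
       MemLp (fun z => (Real.sqrt (1 + ‖z‖ ^ 2) : ℂ) * u z) 2 volume}

/-- The Hamiltonian `𝓗(u) = ¼ ∫ |u|⁴`. -/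
def hamiltonian (u : ℂ → ℂ) : ℝ := (1 / 4) * ∫ z : ℂ, ‖u z‖ ^ 4

/-- The mass `M(u) = ∫ |u|²`. -/
def mass (u : ℂ → ℂ) : ℝ := ∫ z : ℂ, ‖u z‖ ^ 2

/-- The angular momentum `P(u) = ∫ (|z|² - 1) |u|²`. -/
def angularMomentum (u : ℂ → ℂ) : ℝ := ∫ z : ℂ, (‖z‖ ^ 2 - 1) * ‖u z‖ ^ 2

/-- The magnetic momentum `Q(u) = ∫ z |u|²`. -/
def magneticMomentum (u : ℂ → ℂ) : ℂ := ∫ z : ℂ, z * (‖u z‖ ^ 2 : ℝ)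

/-- The functional `B(u) = 4π𝓗(u) + ¼ (M(u)P(u) - |Q(u)|²) - ½ M(u)²`. -/
def functionalB (u : ℂ → ℂ) : ℝ :=
  4 * Real.pi * hamiltonian u
    + (1 / 4) * (mass u * angularMomentum u - ‖magneticMomentum u‖ ^ 2)
    - (1 / 2) * mass u ^ 2

/-- The special Hermite functions `φ_n(z) = (π n!)^{-1/2} z^n e^{-|z|²/2}`, the standard
Hilbert basis of the Bargmann–Fock space. -/
def hermiteFun (n : ℕ) (z : ℂ) : ℂ :=
  (1 / Real.sqrt (Real.pi * n.factorial) : ℝ) * z ^ n * (Real.exp (-‖z‖ ^ 2 / 2) : ℂ)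

/-- The coefficient `a_n = ⟨φ_n, u⟩_{L²}` of `u` in the basis `(φ_n)`. -/
def coeff (u : ℂ → ℂ) (n : ℕ) : ℂ :=
  ∫ z : ℂ, (starRingEnd ℂ) (hermiteFun n z) * u z

/-- The variables `A_{jk} = a_k a_{j-k} / √(k! (j-k)!)`, `0 ≤ k ≤ j`. -/
def varA (a : ℕ → ℂ) (j : ℕ) (k : Fin (j + 1)) : ℂ :=
  a k * a (j - k) / (Real.sqrt ((k : ℕ).factorial * (j - k : ℕ).factorial) : ℂ)

/-- The block matrix `B^{(j)}` of order `j + 1`, rows and columns indexed by `0, …, j`. -/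
def blockB (j : ℕ) : Matrix (Fin (j + 1)) (Fin (j + 1)) ℝ :=
  Matrix.of fun k l =>
    (j.factorial : ℝ) / 2 ^ (j + 1) +
      if (k : ℕ) = l then
        (1 / 8) * ((j : ℝ) - 4) * (k : ℕ).factorial * (j - k : ℕ).factorial
      else if (l : ℕ) = k + 1 then
        -(1 / 8) * ((k : ℕ) + 1).factorial * (j - k : ℕ).factorial
      else if (k : ℕ) = l + 1 then
        -(1 / 8) * ((l : ℕ) + 1).factorial * (j - l : ℕ).factorial
      else 0

/-- A vector `v` of size `j + 1` is symmetric when `v_k = v_{j-k}` for all `0 ≤ k ≤ j`. -/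
def IsSymmVec {j : ℕ} (v : Fin (j + 1) → ℂ) : Prop := ∀ k, v k.rev = v k

/-- The Hermitian form `∑_{k,l} X_{kl} conj(v_k) v_l` of a real matrix. -/
def hermForm {j : ℕ} (X : Matrix (Fin (j + 1)) (Fin (j + 1)) ℝ) (v : Fin (j + 1) → ℂ) : ℂ :=
  ∑ k, ∑ l, (X k l : ℂ) * (starRingEnd ℂ) (v k) * v l

end LLL

end

namespace LLL


/-! Write u as the Gaussian times an entire f with Taylor coefficients c_n, and put α_n = √π c_n, so
that a_n = √(n!) α_n and A_{jk} = α_k α_{j-k}. Orthogonality of monomials for Gaussian weights turns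
M, P, Q and 𝓗 into series in α. Cauchy products then group MP, |Q|², M² and 𝓗 by the total degree j,
and degree j contributes exactly the Hermitian form of B^{(j)} (`exists_coeff_hasSum`,
`hasSum_hermForm_conv`).

Positivity is a spectral gap. With p_k = k!(j-k)! v_k, the form of B^{(j)} is, up to the factor
8·j!, the quantity E(p) + 4·2^{-j}|∑ C(j,k) p_k|² - 4 ∑ C(j,k)|p_k|², where E is the binomial
Dirichlet form. This is the Dirichlet form of the hypercube {0,1}^j on functions of the Hamming
weight, with eigenvalues 0, 2, 4, .... The symmetry p_{j-k} = p_k removes the eigenvalue 2, so the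
gap above the constants is 4 (`binomEnergy_poincare`). -/

/-! ### Poincaré inequality for the binomial law. -/

/-- The binomial sum `∑_{k ≤ j} C(j,k) f(k)`, by Pascal's recursion. -/
def binomSum {M : Type*} [AddCommMonoid M] : ℕ → (ℕ → M) → M
  | 0, f => f 0
  | j + 1, f => binomSum j f + binomSum j fun k => f (k + 1)

/-- The Dirichlet form `∑_{k < j} (j - k) C(j,k) |p(k+1) - p(k)|²` of the binomial law. -/
noncomputable def binomEnergy : ℕ → (ℕ → ℂ) → ℝ
  | 0, _ => 0
  | j + 1, p => binomEnergy j p + binomEnergy j (fun k => p (k + 1)) +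
      binomSum j fun k => ‖p (k + 1) - p k‖ ^ 2

theorem binomSum_add {M : Type*} [AddCommMonoid M] (j : ℕ) (f g : ℕ → M) :
    binomSum j (fun k => f k + g k) = binomSum j f + binomSum j g := by
  induction j generalizing f g with
  | zero => rfl
  | succ j ih => simp only [binomSum, ih]; abel

theorem binomSum_const_mul {R : Type*} [Semiring R] (j : ℕ) (c : R) (f : ℕ → R) :
    binomSum j (fun k => c * f k) = c * binomSum j f := by
  induction j generalizing f with
  | zero => rfl
  | succ j ih => simp only [binomSum, ih, mul_add]

theorem binomSum_congr {M : Type*} [AddCommMonoid M] {j : ℕ} {f g : ℕ → M}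
    (h : ∀ k ≤ j, f k = g k) : binomSum j f = binomSum j g := by
  induction j generalizing f g with
  | zero => exact h 0 le_rfl
  | succ j ih =>
    simp only [binomSum]
    rw [ih fun k hk => h k (by omega), ih fun k hk => h (k + 1) (by omega)]

theorem binomSum_nonneg (j : ℕ) {f : ℕ → ℝ} (h : ∀ k, 0 ≤ f k) : 0 ≤ binomSum j f := by
  induction j generalizing f with
  | zero => exact h 0
  | succ j ih => exact add_nonneg (ih h) (ih fun k => h (k + 1))

theorem binomSum_eq_sum {R : Type*} [CommSemiring R] (j : ℕ) (f : ℕ → R) :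
    binomSum j f = ∑ k ∈ Finset.range (j + 1), (j.choose k : R) * f k := by
  induction j generalizing f with
  | zero => simp [binomSum]
  | succ j ih =>
    rw [binomSum, ih, ih, Finset.sum_range_succ' _ (j + 1)]
    simp only [Nat.choose_succ_succ, Nat.cast_add, add_mul, Finset.sum_add_distrib]
    rw [Finset.sum_range_succ' _ j, Finset.sum_range_succ (fun k => (j.choose (k + 1) : R) * _) j]
    simp
    ring

theorem norm_sq_add_norm_sub_sq (x y : ℂ) :
    ‖x + y‖ ^ 2 + ‖x - y‖ ^ 2 = 2 * ‖x‖ ^ 2 + 2 * ‖y‖ ^ 2 := by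
  simp only [← Complex.normSq_eq_norm_sq, Complex.normSq_apply, Complex.add_re, Complex.add_im,
    Complex.sub_re, Complex.sub_im]
  ring

theorem binomSum_parallelogram (j : ℕ) (p q : ℕ → ℂ) :
    binomSum j (fun k => ‖p k + q k‖ ^ 2) + binomSum j (fun k => ‖p k - q k‖ ^ 2) =
      2 * binomSum j (fun k => ‖p k‖ ^ 2) + 2 * binomSum j (fun k => ‖q k‖ ^ 2) := by
  rw [← binomSum_add, ← binomSum_const_mul, ← binomSum_const_mul, ← binomSum_add]
  exact binomSum_congr fun k _ => norm_sq_add_norm_sub_sq _ _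

theorem binomEnergy_parallelogram (j : ℕ) (p q : ℕ → ℂ) :
    binomEnergy j (fun k => p k + q k) + binomEnergy j (fun k => p k - q k) =
      2 * binomEnergy j p + 2 * binomEnergy j q := by
  induction j generalizing p q with
  | zero => simp [binomEnergy]
  | succ j ih =>
    have h1 := ih p q
    have h2 := ih (fun k => p (k + 1)) (fun k => q (k + 1))
    have h3 := binomSum_parallelogram j (fun k => p (k + 1) - p k) (fun k => q (k + 1) - q k)
    have e1 : binomSum j (fun k => ‖p (k + 1) + q (k + 1) - (p k + q k)‖ ^ 2) =
        binomSum j (fun k => ‖p (k + 1) - p k + (q (k + 1) - q k)‖ ^ 2) :=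
      binomSum_congr fun k _ => by congr 2; ring
    have e2 : binomSum j (fun k => ‖p (k + 1) - q (k + 1) - (p k - q k)‖ ^ 2) =
        binomSum j (fun k => ‖p (k + 1) - p k - (q (k + 1) - q k)‖ ^ 2) :=
      binomSum_congr fun k _ => by congr 2; ring
    simp only [binomEnergy]
    rw [e1, e2]
    linarith

theorem binomEnergy_nonneg (j : ℕ) (p : ℕ → ℂ) : 0 ≤ binomEnergy j p := by
  induction j generalizing p with
  | zero => exact le_rfl
  | succ j ih =>
    exact add_nonneg (add_nonneg (ih _) (ih _)) (binomSum_nonneg _ fun _ => by positivity)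

/-- The recursion suits the induction on j, the closed sum suits comparison with the matrices. They
agree because (i+1) C(i,k) = (i+1-k) C(i+1,k). -/
theorem binomEnergy_eq (j : ℕ) (p : ℕ → ℂ) :
    binomEnergy j p = ∑ k ∈ Finset.range j, ((j - k) * j.choose k : ℝ) * ‖p (k + 1) - p k‖ ^ 2 := by
  have key : ∀ (i : ℕ) (p : ℕ → ℂ),
      binomEnergy (i + 1) p = (i + 1) * binomSum i (fun k => ‖p (k + 1) - p k‖ ^ 2) := by
    intro i
    induction i with
    | zero => intro p; simp [binomEnergy]
    | succ i ih =>
      intro p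
      rw [binomEnergy, ih, ih]
      simp only [binomSum]
      push_cast
      ring
  cases j with
  | zero => simp [binomEnergy]
  | succ i =>
    rw [key, binomSum_eq_sum, Finset.mul_sum]
    refine Finset.sum_congr rfl fun k hk => ?_
    have hk' : k ≤ i := by simpa [Nat.lt_succ_iff] using hk
    have h : ((i + 1 : ℕ) : ℝ) * i.choose k = (i + 1).choose k * ((i + 1 : ℕ) - k : ℝ) := by
      have := Nat.add_one_mul_choose_eq i k
      have h2 := Nat.choose_succ_right_eq (i + 1) k
      rw [← Nat.cast_sub (by omega), ← Nat.cast_mul, ← Nat.cast_mul, ← h2, this]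
    push_cast at h ⊢
    linear_combination ‖p (k + 1) - p k‖ ^ 2 * h

/-- The Poincaré inequality of the binomial law, with the constants for functions that are odd
and even under `k ↦ j - k`. -/
theorem binomEnergy_poincare (j : ℕ) :
    (∀ p : ℕ → ℂ, (∀ k ≤ j, p (j - k) = -p k) →
      2 * binomSum j (fun k => ‖p k‖ ^ 2) ≤ binomEnergy j p) ∧
    (∀ p : ℕ → ℂ, (∀ k ≤ j, p (j - k) = p k) →
      4 * binomSum j (fun k => ‖p k‖ ^ 2) ≤ binomEnergy j p + 4 / 2 ^ j * ‖binomSum j p‖ ^ 2) := by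
  induction j with
  | zero =>
    refine ⟨fun p hp => ?_, fun p _ => ?_⟩
    · have h : p 0 = 0 := by
        have := hp 0 le_rfl
        exact self_eq_neg.mp this
      simp [binomSum, binomEnergy, h]
    · simp [binomSum, binomEnergy]
  | succ j ih =>
    obtain ⟨ihA, ihS⟩ := ih
    -- Splitting off one coordinate of the cube: the sums s_k = p_{k+1} + p_k and differences d_k =
    -- p_{k+1} - p_k decouple both quadratic forms, and the mean of p is seen by s alone.
    have hdec : ∀ (p : ℕ → ℂ),
        2 * binomSum (j + 1) (fun k => ‖p k‖ ^ 2) =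
          binomSum j (fun k => ‖p (k + 1) + p k‖ ^ 2) +
          binomSum j (fun k => ‖p (k + 1) - p k‖ ^ 2) ∧
        2 * binomEnergy (j + 1) p = binomEnergy j (fun k => p (k + 1) + p k) +
          binomEnergy j (fun k => p (k + 1) - p k) +
          2 * binomSum j (fun k => ‖p (k + 1) - p k‖ ^ 2) ∧
        binomSum (j + 1) p = binomSum j (fun k => p (k + 1) + p k) := by
      intro p
      have h1 := binomSum_parallelogram j (fun k => p (k + 1)) p
      have h2 := binomEnergy_parallelogram j (fun k => p (k + 1)) p
      have h3 := binomSum_add j (fun k => p (k + 1)) p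
      simp only [binomSum, binomEnergy] at *
      refine ⟨by linarith, by linarith, by rw [h3, add_comm]⟩
    refine ⟨fun p hp => ?_, fun p hp => ?_⟩
    -- For odd p, s is odd and d is even. The explicit term in |d|² already supplies the constant 2
    -- for d, so its energy is only needed to be non-negative.
    · obtain ⟨h1, h2, -⟩ := hdec p
      have hg := ihA (fun k => p (k + 1) + p k) fun k hk => by
        have e1 := hp k (by omega)
        have e2 := hp (k + 1) (by omega)
        rw [show j + 1 - k = j - k + 1 by omega] at e1
        rw [show j + 1 - (k + 1) = j - k by omega] at e2
        simp only [e1, e2]; ring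
      have hh := binomEnergy_nonneg j (fun k => p (k + 1) - p k)
      linarith
    -- For even p, s is even and d is odd. The odd gap 2 plus the explicit term, also worth 2, gives
    -- the constant 4 for d.
    · obtain ⟨h1, h2, h3⟩ := hdec p
      have e : ∀ k ≤ j, p (j - k + 1) = p k ∧ p (j - k) = p (k + 1) := fun k hk => by
        have e1 := hp k (by omega)
        have e2 := hp (k + 1) (by omega)
        rw [show j + 1 - k = j - k + 1 by omega] at e1
        rw [show j + 1 - (k + 1) = j - k by omega] at e2
        exact ⟨e1, e2⟩
      have hg := ihS (fun k => p (k + 1) + p k) fun k hk => by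
        simp only [(e k hk).1, (e k hk).2]; ring
      have hh := ihA (fun k => p (k + 1) - p k) fun k hk => by
        simp only [(e k hk).1, (e k hk).2]; ring
      rw [h3]
      have : (4 : ℝ) / 2 ^ (j + 1) = 4 / 2 ^ j / 2 := by rw [pow_succ]; field_simp
      rw [this]
      linarith

/-! ### The blocks B^{(j)} and their positivity. -/

theorem hermForm_blockB_eq (j : ℕ) (w : ℕ → ℂ) :
    hermForm (blockB j) (fun k => w k) =
      (j.factorial : ℂ) / 2 ^ (j + 1) * (starRingEnd ℂ (∑ k ∈ Finset.range (j + 1), w k) *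
        ∑ k ∈ Finset.range (j + 1), w k) +
      ((j : ℂ) - 4) / 8 * ∑ k ∈ Finset.range (j + 1),
        (k.factorial * (j - k).factorial : ℂ) * (starRingEnd ℂ (w k) * w k) -
      1 / 8 * ∑ k ∈ Finset.range j, ((k + 1).factorial * (j - k).factorial : ℂ) *
        (starRingEnd ℂ (w k) * w (k + 1) + starRingEnd ℂ (w (k + 1)) * w k) := by
  let e : ℕ → ℕ → ℂ := fun k l =>
    (j.factorial : ℂ) / 2 ^ (j + 1) * (starRingEnd ℂ (w k) * w l) +
    (if k = l then ((j : ℂ) - 4) / 8 *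
      ((k.factorial * (j - k).factorial : ℂ) * (starRingEnd ℂ (w k) * w k)) else 0) +
    ((if l = k + 1 then -(1 / 8) *
      (((k + 1).factorial * (j - k).factorial : ℂ) * (starRingEnd ℂ (w k) * w (k + 1))) else 0) +
    (if k = l + 1 then -(1 / 8) *
      (((l + 1).factorial * (j - l).factorial : ℂ) * (starRingEnd ℂ (w (l + 1)) * w l)) else 0))
  have h1 : hermForm (blockB j) (fun k => w k) =
      ∑ k ∈ Finset.range (j + 1), ∑ l ∈ Finset.range (j + 1), e k l := by
    rw [← Fin.sum_univ_eq_sum_range (fun k => ∑ l ∈ Finset.range (j + 1), e k l)]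
    refine Finset.sum_congr rfl fun k _ => ?_
    rw [← Fin.sum_univ_eq_sum_range (fun l => e k l)]
    refine Finset.sum_congr rfl fun l _ => ?_
    generalize hk : (k : ℕ) = k'
    generalize hl : (l : ℕ) = l'
    simp only [blockB, Matrix.of_apply, hk, hl, e]
    by_cases c1 : k' = l'
    · subst c1
      simp
      ring
    by_cases c2 : l' = k' + 1
    · have c3 : ¬k' = l' + 1 := by omega
      rw [if_neg c1, if_neg c1, if_pos c2, if_pos c2, if_neg c3]
      subst c2
      push_cast
      ring
    by_cases c3 : k' = l' + 1
    · rw [if_neg c1, if_neg c1, if_neg c2, if_neg c2, if_pos c3, if_pos c3]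
      subst c3
      push_cast
      ring
    simp [c1, c2, c3]
    ring
  have hU : ∀ F : ℕ → ℂ, ∑ k ∈ Finset.range (j + 1), ∑ l ∈ Finset.range (j + 1),
      (if l = k + 1 then F k else 0) = ∑ k ∈ Finset.range j, F k := by
    intro F
    simp only [Finset.sum_ite_eq', Finset.mem_range]
    rw [Finset.sum_range_succ]
    simp only [lt_irrefl, if_false, add_zero]
    exact Finset.sum_congr rfl fun k hk => if_pos (by simpa using hk)
  rw [h1]
  simp only [e, Finset.sum_add_distrib]
  rw [hU]
  rw [Finset.sum_comm (f := fun k l => if k = l + 1 then _ else _), hU]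
  simp only [Finset.sum_ite_eq, Finset.mem_range, ← Finset.mul_sum, map_sum, Finset.sum_mul_sum]
  rw [Finset.sum_congr rfl (fun k hk => if_pos (by simpa using hk)), ← Finset.mul_sum]
  simp only [mul_add, Finset.sum_add_distrib]
  ring

theorem blockB_isSymm (j : ℕ) : (blockB j).IsSymm := by
  ext k l
  simp only [blockB, Matrix.transpose_apply, Matrix.of_apply]
  by_cases c1 : (k : ℕ) = l
  · rw [Fin.ext c1]
  · have c1' : ¬(l : ℕ) = k := fun h => c1 h.symm
    by_cases c2 : (l : ℕ) = k + 1
    · have c3 : ¬(k : ℕ) = l + 1 := by omega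
      rw [if_neg c1, if_neg c1', if_neg c3, if_pos c2, if_pos c2]
    · by_cases c3 : (k : ℕ) = l + 1
      · have : ¬(l : ℕ) = k + 1 := by omega
        simp only [if_neg c1, if_neg c1', if_neg this, if_pos c3]
      · simp [c1, c1', c2, c3]

/-- The block form is the deficit in the even Poincaré inequality, divided by 8·j!. -/
theorem hermForm_blockB_of_symm (j : ℕ) (w : ℕ → ℂ) (hw : ∀ k ≤ j, w (j - k) = w k) :
    ∃ r : ℝ, 0 ≤ r ∧ hermForm (blockB j) (fun k => w k) = r := by
  -- Since C(j,k) k!(j-k)! = j!, this rescaling turns the plain sum of w into a binomial sum and the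
  -- factorial weights into binomial ones.
  let p : ℕ → ℂ := fun k => (k.factorial * (j - k).factorial : ℂ) * w k
  have hp : ∀ k ≤ j, p (j - k) = p k := fun k hk => by
    simp only [p, hw k hk, show j - (j - k) = k by omega]; ring
  have hfac : ∀ k ≤ j, (j.choose k : ℂ) * (k.factorial * (j - k).factorial) = j.factorial :=
    fun k hk => by
      have := Nat.choose_mul_factorial_mul_factorial hk
      rw [← this]; push_cast; ring
  have hj : (j.factorial : ℂ) ≠ 0 := by exact_mod_cast j.factorial_ne_zero
  have hsum : binomSum j p = j.factorial * ∑ k ∈ Finset.range (j + 1), w k := by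
    rw [binomSum_eq_sum, Finset.mul_sum]
    refine Finset.sum_congr rfl fun k hk => ?_
    have := hfac k (by simpa [Nat.lt_succ_iff] using hk)
    simp only [p]
    linear_combination w k * this
  have hsq : ((binomSum j (fun k => ‖p k‖ ^ 2) : ℝ) : ℂ) = j.factorial *
      ∑ k ∈ Finset.range (j + 1), (k.factorial * (j - k).factorial : ℂ) *
        (starRingEnd ℂ (w k) * w k) := by
    rw [binomSum_eq_sum, Finset.mul_sum]
    push_cast
    refine Finset.sum_congr rfl fun k hk => ?_
    have := hfac k (by simpa [Nat.lt_succ_iff] using hk)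
    rw [← Complex.conj_mul']
    simp only [p, map_mul, map_natCast]
    linear_combination (k.factorial * (j - k).factorial : ℂ) *
        (starRingEnd ℂ (w k) * w k) * this
  have hen : ((binomEnergy j p : ℝ) : ℂ) = j.factorial *
      (j * ∑ k ∈ Finset.range (j + 1), (k.factorial * (j - k).factorial : ℂ) *
        (starRingEnd ℂ (w k) * w k) - ∑ k ∈ Finset.range j,
        ((k + 1).factorial * (j - k).factorial : ℂ) *
        (starRingEnd ℂ (w k) * w (k + 1) + starRingEnd ℂ (w (k + 1)) * w k)) := by
    -- Write j = (j-k) + k and shift the second part by one. Each pair of neighbours k, k+1 then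
    -- receives the two square terms of |p_{k+1} - p_k|². The boundary terms k = j and k = 0 have
    -- weight zero.
    have hsplit : (j : ℂ) * ∑ k ∈ Finset.range (j + 1), (k.factorial * (j - k).factorial : ℂ) *
        (starRingEnd ℂ (w k) * w k) = ∑ k ∈ Finset.range j,
        (((j : ℂ) - k) * (k.factorial * (j - k).factorial) * (starRingEnd ℂ (w k) * w k) +
        ((k : ℂ) + 1) * ((k + 1).factorial * (j - (k + 1)).factorial) *
          (starRingEnd ℂ (w (k + 1)) * w (k + 1))) := by
      have hA : ∑ k ∈ Finset.range (j + 1),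
          ((j : ℂ) - k) * (k.factorial * (j - k).factorial) * (starRingEnd ℂ (w k) * w k) =
          ∑ k ∈ Finset.range j,
          ((j : ℂ) - k) * (k.factorial * (j - k).factorial) * (starRingEnd ℂ (w k) * w k) := by
        rw [Finset.sum_range_succ]; simp
      have hB : ∑ k ∈ Finset.range (j + 1),
          (k : ℂ) * (k.factorial * (j - k).factorial) * (starRingEnd ℂ (w k) * w k) =
          ∑ k ∈ Finset.range j,
          ((k : ℂ) + 1) * ((k + 1).factorial * (j - (k + 1)).factorial) *
          (starRingEnd ℂ (w (k + 1)) * w (k + 1)) := by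
        rw [Finset.sum_range_succ']; simp
      rw [Finset.sum_add_distrib, ← hA, ← hB, ← Finset.sum_add_distrib, Finset.mul_sum]
      exact Finset.sum_congr rfl fun k _ => by ring
    rw [hsplit, ← Finset.sum_sub_distrib, Finset.mul_sum, binomEnergy_eq]
    push_cast
    refine Finset.sum_congr rfl fun k hk => ?_
    have hk' : k < j := by simpa using hk
    obtain ⟨i, rfl⟩ : ∃ i, j = k + 1 + i := ⟨j - (k + 1), by omega⟩
    have h1 := hfac k (by omega)
    rw [← Complex.conj_mul']
    simp only [p, map_mul, map_natCast, map_sub]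
    rw [show k + 1 + i - k = i + 1 by omega, show k + 1 + i - (k + 1) = i by omega] at *
    rw [Nat.factorial_succ i] at *
    rw [Nat.factorial_succ k] at *
    rw [← h1]
    push_cast
    ring
  have hP := (binomEnergy_poincare j).2 p hp
  refine ⟨(binomEnergy j p + 4 / 2 ^ j * ‖binomSum j p‖ ^ 2 -
      4 * binomSum j (fun k => ‖p k‖ ^ 2)) / (8 * j.factorial),
    div_nonneg (by linarith) (by positivity), ?_⟩
  rw [hermForm_blockB_eq]
  push_cast
  rw [hen, hsq, ← Complex.conj_mul', hsum]
  simp only [map_mul, map_natCast]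
  rw [pow_succ]
  field_simp
  ring

theorem hermForm_blockB_nonneg (j : ℕ) (v : Fin (j + 1) → ℂ) (hv : IsSymmVec v) :
    0 ≤ (hermForm (blockB j) v).re ∧ (hermForm (blockB j) v).im = 0 := by
  let w : ℕ → ℂ := fun k => if h : k < j + 1 then v ⟨k, h⟩ else 0
  have hvw : v = fun k : Fin (j + 1) => w k := by
    funext k
    simp only [w, k.isLt, dif_pos]
  obtain ⟨r, hr, h⟩ := hermForm_blockB_of_symm j w fun k hk => by
    have h1 : k < j + 1 := by omega
    have h2 : j - k < j + 1 := by omega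
    simp only [w, h1, h2, dif_pos]
    rw [← hv ⟨k, h1⟩]
    congr 1
    ext
    simp [Fin.val_rev]
  rw [hvw, h]
  simpa using hr


/-! ### Gaussian-weighted norms in terms of Taylor coefficients. -/

theorem integral_exp_int_mul_I (k : ℤ) :
    ∫ θ in Set.Ioo (-Real.pi) Real.pi, Complex.exp (k * θ * Complex.I) =
      if k = 0 then (2 * Real.pi : ℂ) else 0 := by
  rw [← integral_Ioc_eq_integral_Ioo, ← intervalIntegral.integral_of_le (by linarith [Real.pi_pos])]
  split_ifs with hk
  · subst hk
    simp
    ring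
  · have hk' : (k : ℂ) * Complex.I ≠ 0 := mul_ne_zero (by exact_mod_cast hk) Complex.I_ne_zero
    have h := integral_exp_mul_complex (a := -Real.pi) (b := Real.pi) hk'
    have e : ∀ θ : ℝ, (k : ℂ) * θ * Complex.I = k * Complex.I * θ := fun θ => by ring
    simp only [e]
    rw [h, div_eq_zero_iff]
    left
    rw [sub_eq_zero, Complex.exp_eq_exp_iff_exists_int]
    exact ⟨k, by push_cast; ring⟩

/-- Parseval's identity on the circle for an absolutely convergent Fourier series. -/
theorem hasSum_circle_norm_sq {d : ℕ → ℂ} (hd : Summable fun n => ‖d n‖) :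
    HasSum (fun n => 2 * Real.pi * ‖d n‖ ^ 2)
      (∫ θ in Set.Ioo (-Real.pi) Real.pi, ‖∑' n, d n * Complex.exp (n * θ * Complex.I)‖ ^ 2) := by
  -- The square is expanded into a double series, absolutely summable uniformly in θ. Termwise
  -- integration kills everything off the diagonal.
  let F : ℕ × ℕ → ℝ → ℂ := fun p θ =>
    starRingEnd ℂ (d p.1) * d p.2 * Complex.exp (((p.2 : ℤ) - (p.1 : ℤ) : ℤ) * θ * Complex.I)
  have hnorm : ∀ p θ, ‖F p θ‖ = ‖d p.1‖ * ‖d p.2‖ := fun p θ => by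
    simp only [F, norm_mul, RCLike.norm_conj]
    rw [← Complex.ofReal_intCast, ← Complex.ofReal_mul, Complex.norm_exp_ofReal_mul_I, mul_one]
  have hcont : ∀ p, Continuous (F p) := fun p => by
    simp only [F]; fun_prop
  have hint : ∀ p, Integrable (F p) (volume.restrict (Set.Ioo (-Real.pi) Real.pi)) := fun p =>
    (((hcont p).continuousOn (s := Set.Icc (-Real.pi) Real.pi)).integrableOn_Icc).mono_set
      Set.Ioo_subset_Icc_self
  have hsum : Summable fun p : ℕ × ℕ => ‖d p.1‖ * ‖d p.2‖ :=
    hd.mul_of_nonneg hd (fun _ => norm_nonneg _) fun _ => norm_nonneg _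
  have h := hasSum_integral_of_summable_integral_norm hint (by
    simp only [hnorm, integral_const]
    exact hsum.const_smul _)
  have hF : ∀ θ : ℝ, ∑' p, F p θ =
      ((‖∑' n, d n * Complex.exp (n * θ * Complex.I)‖ ^ 2 : ℝ) : ℂ) := fun θ => by
    have hn : ∀ n : ℕ, ‖d n * Complex.exp (n * θ * Complex.I)‖ = ‖d n‖ := fun n => by
      rw [norm_mul, ← Complex.ofReal_natCast, ← Complex.ofReal_mul, Complex.norm_exp_ofReal_mul_I,
        mul_one]
    have h1 : Summable fun n => ‖d n * Complex.exp (n * θ * Complex.I)‖ := by simpa only [hn]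
    have h2 : Summable fun n => ‖starRingEnd ℂ (d n * Complex.exp (n * θ * Complex.I))‖ := by
      simpa only [RCLike.norm_conj]
    rw [Complex.ofReal_pow, ← Complex.conj_mul', Complex.conj_tsum,
      tsum_mul_tsum_of_summable_norm h2 h1]
    refine tsum_congr fun p => ?_
    simp only [F, map_mul, ← Complex.exp_conj, map_natCast, Complex.conj_ofReal, Complex.conj_I]
    have : Complex.exp ((((p.2 : ℤ) - (p.1 : ℤ) : ℤ) : ℂ) * θ * Complex.I) =
        Complex.exp (p.1 * θ * -Complex.I) * Complex.exp (p.2 * θ * Complex.I) := by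
      rw [← Complex.exp_add]
      congr 1
      push_cast
      ring
    rw [this]
    ring
  simp only [hF, integral_complex_ofReal] at h
  have hdiag : ∀ p : ℕ × ℕ, ∫ θ in Set.Ioo (-Real.pi) Real.pi, F p θ =
      if p.1 = p.2 then ((2 * Real.pi * ‖d p.1‖ ^ 2 : ℝ) : ℂ) else 0 := fun p => by
    simp only [F]
    rw [integral_const_mul, integral_exp_int_mul_I]
    by_cases hp : p.1 = p.2
    · rw [if_pos hp, if_pos (by omega), hp, Complex.conj_mul']
      push_cast
      ring
    · rw [if_neg hp, if_neg (by omega), mul_zero]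
  simp only [hdiag] at h
  have hinj : Function.Injective fun n : ℕ => (n, n) := fun a b hab => (Prod.ext_iff.mp hab).1
  rw [← hinj.hasSum_iff] at h
  · simp only [Function.comp_def, if_true] at h
    exact_mod_cast h
  · rintro ⟨m, n⟩ hmn
    refine if_neg fun h => hmn ⟨m, ?_⟩
    simp only at h
    rw [h]

theorem lintegral_radial {a : ℝ} (ha : 0 < a) (n : ℕ) :
    ∫⁻ r in Set.Ioi (0 : ℝ), ENNReal.ofReal (2 * Real.pi * (r ^ (2 * n + 1) *
      Real.exp (-a * r ^ 2))) = ENNReal.ofReal (Real.pi * n.factorial / a ^ (n + 1)) := by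
  have h := integral_rpow_mul_exp_neg_mul_rpow (p := 2) (q := (2 * n + 1 : ℕ)) (b := a)
    (by norm_num) (by have : (0 : ℝ) ≤ (2 * n + 1 : ℕ) := by positivity
                      linarith) ha
  have e1 : -(((2 * n + 1 : ℕ) : ℝ) + 1) / 2 = -((n + 1 : ℕ) : ℝ) := by push_cast; ring
  have e2 : (((2 * n + 1 : ℕ) : ℝ) + 1) / 2 = (n : ℝ) + 1 := by push_cast; ring
  rw [e1, e2, Real.Gamma_nat_eq_factorial, Real.rpow_neg ha.le, Real.rpow_natCast] at h
  have e3 : ∀ r : ℝ, r ^ ((2 * n + 1 : ℕ) : ℝ) * Real.exp (-a * r ^ (2 : ℝ)) =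
      r ^ (2 * n + 1) * Real.exp (-a * r ^ 2) := fun r => by
    rw [Real.rpow_natCast, Real.rpow_two]
  simp only [e3] at h
  -- A non-integrable function has integral 0 by convention, so the positive value in `h` forces
  -- integrability.
  have hint : IntegrableOn (fun r : ℝ => r ^ (2 * n + 1) * Real.exp (-a * r ^ 2)) (Set.Ioi 0) := by
    by_contra hc
    have h0 := integral_undef hc
    rw [h0] at h
    have : (0 : ℝ) < (a ^ (n + 1))⁻¹ * (1 / 2) * n.factorial := by positivity
    linarith
  rw [← ofReal_integral_eq_lintegral_ofReal (hint.const_mul _), integral_const_mul, h]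
  · congr 1
    field_simp
  · refine (ae_restrict_iff' measurableSet_Ioi).mpr (Filter.Eventually.of_forall fun r hr => ?_)
    have : (0 : ℝ) < r := hr
    simp only [Pi.zero_apply]
    positivity

/-- The norm of an entire function in a Bargmann–Fock space in terms of its Taylor coefficients. -/
theorem lintegral_norm_sq_mul_gaussian {f : ℂ → ℂ} {c : ℕ → ℂ} {a : ℝ} (ha : 0 < a)
    (hf : Continuous f) (hc : ∀ z, HasSum (fun n => c n * z ^ n) (f z)) :
    ∫⁻ z, ENNReal.ofReal (‖f z‖ ^ 2 * Real.exp (-a * ‖z‖ ^ 2)) =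
      ∑' n : ℕ, ENNReal.ofReal (‖c n‖ ^ 2 * (Real.pi * n.factorial / a ^ (n + 1))) := by
  -- In [0,∞] polar coordinates and Tonelli need no integrability. The identity can thus be read
  -- both ways, from integrability to summability and back.
  rw [← Complex.lintegral_comp_polarCoord_symm]
  simp only [Complex.polarCoord_symm_apply, polarCoord_target, smul_eq_mul]
  rw [Measure.volume_eq_prod, setLIntegral_prod _ (by
    refine Measurable.aemeasurable ?_
    have := hf.measurable
    fun_prop)]
  have hpt : ∀ (r θ : ℝ), (r : ℂ) * (Real.cos θ + Real.sin θ * Complex.I) =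
      r * Complex.exp (θ * Complex.I) := fun r θ => by
    rw [Complex.exp_mul_I]; push_cast; rfl
  have hin : ∀ r ∈ Set.Ioi (0 : ℝ), ∫⁻ θ in Set.Ioo (-Real.pi) Real.pi,
      ENNReal.ofReal r * ENNReal.ofReal (‖f (r * (Real.cos θ + Real.sin θ * Complex.I))‖ ^ 2 *
        Real.exp (-a * ‖(r : ℂ) * (Real.cos θ + Real.sin θ * Complex.I)‖ ^ 2)) =
      ∑' n : ℕ, ENNReal.ofReal (‖c n‖ ^ 2) *
        ENNReal.ofReal (2 * Real.pi * (r ^ (2 * n + 1) * Real.exp (-a * r ^ 2))) := by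
    intro r hr
    have hr0 : 0 < r := hr
    have hd : Summable fun n => ‖c n * (r : ℂ) ^ n‖ := (hc r).summable.norm
    have hP := hasSum_circle_norm_sq hd
    have hval : ∀ θ : ℝ, ∑' n : ℕ, c n * (r : ℂ) ^ n * Complex.exp (n * θ * Complex.I) =
        f (r * Complex.exp (θ * Complex.I)) := fun θ => by
      rw [← (hc _).tsum_eq]
      refine tsum_congr fun n => ?_
      rw [mul_pow, ← Complex.exp_nat_mul]
      ring_nf
    simp only [hval] at hP
    have hcont : Continuous fun θ : ℝ => ‖f (r * Complex.exp (θ * Complex.I))‖ ^ 2 := by fun_prop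
    have hint : IntegrableOn (fun θ : ℝ => ‖f (r * Complex.exp (θ * Complex.I))‖ ^ 2)
        (Set.Ioo (-Real.pi) Real.pi) :=
      ((hcont.continuousOn (s := Set.Icc (-Real.pi) Real.pi)).integrableOn_Icc).mono_set
        Set.Ioo_subset_Icc_self
    have hnr : ∀ θ : ℝ, ‖(r : ℂ) * Complex.exp (θ * Complex.I)‖ = r := fun θ => by
      rw [norm_mul, Complex.norm_exp_ofReal_mul_I, mul_one, Complex.norm_real,
        Real.norm_of_nonneg hr0.le]
    simp only [hpt, hnr]
    simp only [← ENNReal.ofReal_mul hr0.le]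
    have e : ∀ θ : ℝ, r * (‖f (r * Complex.exp (θ * Complex.I))‖ ^ 2 * Real.exp (-a * r ^ 2)) =
        r * Real.exp (-a * r ^ 2) * ‖f (r * Complex.exp (θ * Complex.I))‖ ^ 2 := fun θ => by ring
    simp only [e]
    rw [← ofReal_integral_eq_lintegral_ofReal (hint.const_mul _)
      (Filter.Eventually.of_forall fun θ => by simp only [Pi.zero_apply]; positivity),
      integral_const_mul]
    have hS := hP.mul_left (r * Real.exp (-a * r ^ 2))
    rw [← hS.tsum_eq, ENNReal.ofReal_tsum_of_nonneg (fun n => by positivity) hS.summable]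
    refine tsum_congr fun n => ?_
    rw [← ENNReal.ofReal_mul (by positivity)]
    congr 1
    rw [norm_mul, norm_pow, Complex.norm_real, Real.norm_of_nonneg hr0.le]
    ring
  rw [setLIntegral_congr_fun measurableSet_Ioi hin, lintegral_tsum (fun n => by fun_prop)]
  refine tsum_congr fun n => ?_
  rw [lintegral_const_mul _ (by fun_prop), lintegral_radial ha,
    ENNReal.ofReal_mul (by positivity)]


section Fock

variable {f g : ℂ → ℂ} {c d : ℕ → ℂ} {a : ℝ}

theorem hasSum_integral_norm_sq_mul_gaussian (ha : 0 < a) (hf : Continuous f)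
    (hc : ∀ z, HasSum (fun n => c n * z ^ n) (f z))
    (hint : Integrable fun z => ‖f z‖ ^ 2 * Real.exp (-a * ‖z‖ ^ 2)) :
    HasSum (fun n : ℕ => ‖c n‖ ^ 2 * (Real.pi * n.factorial / a ^ (n + 1)))
      (∫ z, ‖f z‖ ^ 2 * Real.exp (-a * ‖z‖ ^ 2)) := by
  have h := lintegral_norm_sq_mul_gaussian ha hf hc
  have h0 : ∀ n : ℕ, 0 ≤ ‖c n‖ ^ 2 * (Real.pi * n.factorial / a ^ (n + 1)) :=
    fun n => by positivity
  rw [← ofReal_integral_eq_lintegral_ofReal hint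
    (Filter.Eventually.of_forall fun z => by simp only [Pi.zero_apply]; positivity)] at h
  have hs : Summable fun n : ℕ => ‖c n‖ ^ 2 * (Real.pi * n.factorial / a ^ (n + 1)) := by
    have := ENNReal.summable_toReal (h ▸ ENNReal.ofReal_ne_top)
    simpa only [ENNReal.toReal_ofReal (h0 _)] using this
  rw [← ENNReal.ofReal_tsum_of_nonneg h0 hs,
    ENNReal.ofReal_eq_ofReal_iff (integral_nonneg fun z => by positivity) (tsum_nonneg h0)] at h
  rw [h]
  exact hs.hasSum

theorem integrable_norm_sq_mul_gaussian (ha : 0 < a) (hf : Continuous f)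
    (hc : ∀ z, HasSum (fun n => c n * z ^ n) (f z))
    (hs : Summable fun n : ℕ => ‖c n‖ ^ 2 * (Real.pi * n.factorial / a ^ (n + 1))) :
    Integrable fun z => ‖f z‖ ^ 2 * Real.exp (-a * ‖z‖ ^ 2) := by
  have h := lintegral_norm_sq_mul_gaussian ha hf hc
  rw [← ENNReal.ofReal_tsum_of_nonneg (fun n => by positivity) hs] at h
  refine ⟨(by fun_prop : Continuous _).aestronglyMeasurable, ?_⟩
  rw [hasFiniteIntegral_iff_ofReal (Filter.Eventually.of_forall fun z => by
    simp only [Pi.zero_apply]; positivity), h]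
  exact ENNReal.ofReal_lt_top

theorem conj_mul_eq_polarization (x y : ℂ) :
    starRingEnd ℂ x * y = 1 / 4 * ((‖x + 1 * y‖ ^ 2 : ℝ) - (‖x + (-1) * y‖ ^ 2 : ℝ) -
      Complex.I * (‖x + Complex.I * y‖ ^ 2 : ℝ) + Complex.I * (‖x + (-Complex.I) * y‖ ^ 2 : ℝ)) := by
  push_cast
  simp only [← Complex.conj_mul', map_add, map_mul, map_neg, map_one, Complex.conj_I]
  linear_combination (1 / 2 * y * starRingEnd ℂ x) * Complex.I_mul_I -
    (1 / 2 * x * starRingEnd ℂ y) * Complex.I_mul_I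

/-- Polarization: the norm identity is applied to f + εg for the four fourth roots of unity ε. -/
theorem integrable_hasSum_conj_mul_gaussian (ha : 0 < a) (hf : Continuous f) (hg : Continuous g)
    (hc : ∀ z, HasSum (fun n => c n * z ^ n) (f z))
    (hd : ∀ z, HasSum (fun n => d n * z ^ n) (g z))
    (hfi : Integrable fun z => ‖f z‖ ^ 2 * Real.exp (-a * ‖z‖ ^ 2))
    (hgi : Integrable fun z => ‖g z‖ ^ 2 * Real.exp (-a * ‖z‖ ^ 2)) :
    Integrable (fun z => starRingEnd ℂ (f z) * g z * Real.exp (-a * ‖z‖ ^ 2)) ∧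
    HasSum (fun n : ℕ => starRingEnd ℂ (c n) * d n * (Real.pi * n.factorial / a ^ (n + 1)))
      (∫ z, starRingEnd ℂ (f z) * g z * Real.exp (-a * ‖z‖ ^ 2)) := by
  let F : ℂ → ℂ → ℂ := fun ε z => ((‖f z + ε * g z‖ ^ 2 * Real.exp (-a * ‖z‖ ^ 2) : ℝ) : ℂ)
  have key : ∀ ε : ℂ, ‖ε‖ = 1 → Integrable (F ε) ∧
      HasSum (fun n : ℕ => ((‖c n + ε * d n‖ ^ 2 * (Real.pi * n.factorial / a ^ (n + 1)) : ℝ) : ℂ))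
        (∫ z, F ε z) := by
    intro ε hε
    have hi : Integrable fun z => ‖f z + ε * g z‖ ^ 2 * Real.exp (-a * ‖z‖ ^ 2) := by
      refine ((hfi.const_mul 2).add (hgi.const_mul 2)).mono'
        (by fun_prop : Continuous _).aestronglyMeasurable (Filter.Eventually.of_forall fun z => ?_)
      rw [Real.norm_of_nonneg (by positivity), Pi.add_apply]
      have h := norm_sq_add_norm_sub_sq (f z) (ε * g z)
      rw [norm_mul, hε, one_mul] at h
      have h2 : ‖f z + ε * g z‖ ^ 2 ≤ 2 * ‖f z‖ ^ 2 + 2 * ‖g z‖ ^ 2 := by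
        nlinarith [sq_nonneg ‖f z - ε * g z‖]
      nlinarith [Real.exp_pos (-a * ‖z‖ ^ 2)]
    refine ⟨hi.ofReal, ?_⟩
    simp only [F]
    rw [integral_complex_ofReal]
    refine Complex.hasSum_ofReal.mpr (hasSum_integral_norm_sq_mul_gaussian ha
      (f := fun z => f z + ε * g z) (by fun_prop) (fun z => ?_) hi)
    refine ((hc z).add ((hd z).mul_left ε)).congr_fun fun n => ?_
    ring
  obtain ⟨i1, s1⟩ := key 1 (by simp)
  obtain ⟨i2, s2⟩ := key (-1) (by simp)
  obtain ⟨i3, s3⟩ := key Complex.I (by simp)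
  obtain ⟨i4, s4⟩ := key (-Complex.I) (by simp)
  have e : ∀ z, starRingEnd ℂ (f z) * g z * Real.exp (-a * ‖z‖ ^ 2) =
      1 / 4 * (F 1 z - F (-1) z - Complex.I * F Complex.I z + Complex.I * F (-Complex.I) z) :=
    fun z => by
      rw [conj_mul_eq_polarization]
      simp only [F]
      push_cast
      ring
  simp only [e]
  have j12 : Integrable fun z => F 1 z - F (-1) z := i1.sub i2
  have j3 := i3.const_mul Complex.I
  have j4 := i4.const_mul Complex.I
  have j123 : Integrable fun z => F 1 z - F (-1) z - Complex.I * F Complex.I z := j12.sub j3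
  refine ⟨(j123.add j4).const_mul _, ?_⟩
  rw [integral_const_mul, integral_add j123 j4, integral_sub j12 j3, integral_sub i1 i2,
    integral_const_mul, integral_const_mul]
  refine ((((s1.sub s2).sub (s3.mul_left Complex.I)).add
    (s4.mul_left Complex.I)).mul_left (1 / 4)).congr_fun fun n => ?_
  rw [conj_mul_eq_polarization]
  push_cast
  ring

end Fock

/-! ### The four integrals as series in the coefficients. -/

/-- Cauchy–Schwarz after writing √(j!) = √C(j,k) · √(k!(j-k)!), with ∑ C(j,k) = 2^j. It bounds the
quartic series by the Cauchy square of the mass series, which makes ∫|u|⁴ finite. -/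
theorem norm_sum_conv_sq_le (x : ℕ → ℂ) (j : ℕ) :
    j.factorial * ‖∑ k ∈ Finset.range (j + 1), x k * x (j - k)‖ ^ 2 ≤
      2 ^ j * ∑ k ∈ Finset.range (j + 1),
        (k.factorial * ‖x k‖ ^ 2) * ((j - k).factorial * ‖x (j - k)‖ ^ 2) := by
  have hCS := Finset.sum_mul_sq_le_sq_mul_sq (Finset.range (j + 1))
    (fun k => Real.sqrt (j.choose k))
    (fun k => Real.sqrt (k.factorial * (j - k).factorial) * (‖x k‖ * ‖x (j - k)‖))
  have hfac : ∀ k ∈ Finset.range (j + 1),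
      Real.sqrt (j.choose k) * (Real.sqrt (k.factorial * (j - k).factorial) *
        (‖x k‖ * ‖x (j - k)‖)) = Real.sqrt j.factorial * (‖x k‖ * ‖x (j - k)‖) := fun k hk => by
    rw [← mul_assoc, ← Real.sqrt_mul (by positivity)]
    congr 2
    rw [← Nat.choose_mul_factorial_mul_factorial (show k ≤ j by
      simpa [Nat.lt_succ_iff] using hk)]
    push_cast
    ring
  rw [Finset.sum_congr rfl hfac, ← Finset.mul_sum, mul_pow, Real.sq_sqrt (by positivity)] at hCS
  have h2 : ∑ k ∈ Finset.range (j + 1), Real.sqrt (j.choose k) ^ 2 = 2 ^ j := by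
    simp only [Real.sq_sqrt (Nat.cast_nonneg _)]
    exact_mod_cast Nat.sum_range_choose j
  have h3 : ∀ k, (Real.sqrt (k.factorial * (j - k).factorial) * (‖x k‖ * ‖x (j - k)‖)) ^ 2 =
      (k.factorial * ‖x k‖ ^ 2) * ((j - k).factorial * ‖x (j - k)‖ ^ 2) := fun k => by
    rw [mul_pow, Real.sq_sqrt (by positivity)]
    ring
  simp only [h2, h3] at hCS
  refine le_trans ?_ hCS
  gcongr
  exact (norm_sum_le _ _).trans_eq (by simp only [norm_mul])

theorem hasSum_sum_range_mul {R : Type*} [NormedRing R] [CompleteSpace R] {x y : ℕ → R} {s t : R}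
    (hx : HasSum x s) (hy : HasSum y t) (hx' : Summable fun n => ‖x n‖)
    (hy' : Summable fun n => ‖y n‖) :
    HasSum (fun j => ∑ k ∈ Finset.range (j + 1), x k * y (j - k)) (s * t) := by
  rw [← hx.tsum_eq, ← hy.tsum_eq, tsum_mul_tsum_eq_tsum_sum_range_of_summable_norm hx' hy']
  exact (summable_norm_sum_mul_range_of_summable_norm hx' hy').of_norm.hasSum


theorem hasSum_coeff_id_mul {f : ℂ → ℂ} {c : ℕ → ℂ} (hc : ∀ z, HasSum (fun n => c n * z ^ n) (f z))
    (z : ℂ) : HasSum (fun n => (if n = 0 then 0 else c (n - 1)) * z ^ n) (z * f z) := by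
  rw [← hasSum_nat_add_iff' 1]
  simp only [Finset.range_one, Finset.sum_singleton, if_true, zero_mul, sub_zero]
  refine ((hc z).mul_left z).congr_fun fun n => ?_
  simp only [Nat.add_eq_zero_iff, one_ne_zero, and_false, if_false, Nat.add_sub_cancel]
  ring

theorem hasSum_coeff_sq {f : ℂ → ℂ} {c : ℕ → ℂ} (hc : ∀ z, HasSum (fun n => c n * z ^ n) (f z))
    (z : ℂ) : HasSum (fun n => (∑ k ∈ Finset.range (n + 1), c k * c (n - k)) * z ^ n)
      (f z ^ 2) := by
  rw [sq]
  refine (hasSum_sum_range_mul (hc z) (hc z) (hc z).summable.norm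
    (hc z).summable.norm).congr_fun fun n => ?_
  rw [Finset.sum_mul]
  refine Finset.sum_congr rfl fun k hk => ?_
  have hk' : k ≤ n := by simpa [Nat.lt_succ_iff] using hk
  rw [← Nat.add_sub_cancel' hk', pow_add, Nat.add_sub_cancel_left]
  ring

/-- Pairing f with z^n, whose Taylor series has one term, isolates c_n. -/
theorem coeff_eq_of_hasSum {u f : ℂ → ℂ} {c : ℕ → ℂ} (hf : Continuous f)
    (hu : ∀ z, u z = (Real.exp (-‖z‖ ^ 2 / 2) : ℂ) * f z)
    (hc : ∀ z, HasSum (fun n => c n * z ^ n) (f z))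
    (hint : Integrable fun z => ‖f z‖ ^ 2 * Real.exp (-1 * ‖z‖ ^ 2)) (n : ℕ) :
    coeff u n = Real.sqrt n.factorial * (Real.sqrt Real.pi * c n) := by
  have hd : ∀ z : ℂ, HasSum (fun m => (if m = n then 1 else 0) * z ^ m) (z ^ n) := fun z => by
    have := hasSum_ite_eq n (z ^ n)
    refine this.congr_fun fun m => ?_
    split_ifs with h <;> simp [h]
  have hdi := integrable_norm_sq_mul_gaussian (a := 1) one_pos (continuous_pow n) hd
    (summable_of_ne_finset_zero (s := {n}) fun m hm => by
      have : m ≠ n := by simpa using hm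
      simp [this])
  obtain ⟨-, h⟩ := integrable_hasSum_conj_mul_gaussian one_pos (continuous_pow n) hf hd hc hdi hint
  have h2 := h.unique (hasSum_single n fun m hm => by simp [hm])
  simp only [if_true, map_one, one_mul, Complex.ofReal_one, one_pow, div_one] at h2
  have e : ∀ z : ℂ, starRingEnd ℂ (hermiteFun n z) * u z =
      ((1 / Real.sqrt (Real.pi * n.factorial) : ℝ) : ℂ) *
        (starRingEnd ℂ (z ^ n) * f z * Real.exp (-1 * ‖z‖ ^ 2)) := fun z => by
    have hexp : Real.exp (-1 * ‖z‖ ^ 2) =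
        Real.exp (-‖z‖ ^ 2 / 2) * Real.exp (-‖z‖ ^ 2 / 2) := by
      rw [← Real.exp_add]; ring_nf
    rw [hermiteFun, hu, map_mul, map_mul, Complex.conj_ofReal, Complex.conj_ofReal, hexp,
      Complex.ofReal_mul]
    ring
  simp only [coeff, e]
  rw [integral_const_mul, h2, Real.sqrt_mul Real.pi_pos.le]
  have h3 : ((Real.sqrt Real.pi : ℝ) : ℂ) ≠ 0 := by
    exact_mod_cast (Real.sqrt_pos.mpr Real.pi_pos).ne'
  have h4 : ((Real.sqrt n.factorial : ℝ) : ℂ) ≠ 0 := by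
    exact_mod_cast (Real.sqrt_pos.mpr (by exact_mod_cast n.factorial_pos)).ne'
  have h5 : (Real.pi : ℂ) = Real.sqrt Real.pi * Real.sqrt Real.pi := by
    exact_mod_cast (Real.mul_self_sqrt Real.pi_pos.le).symm
  have h6 : (n.factorial : ℂ) = Real.sqrt n.factorial * Real.sqrt n.factorial := by
    exact_mod_cast (Real.mul_self_sqrt (Nat.cast_nonneg n.factorial)).symm
  rw [h5, h6]
  push_cast
  field_simp

/-- The four integrals in terms of the rescaled Taylor coefficients `α n = a_n / √n!`. -/
theorem exists_coeff_hasSum {u : ℂ → ℂ} (hu : u ∈ L21E) : ∃ α : ℕ → ℂ,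
    (∀ n, coeff u n = Real.sqrt n.factorial * α n) ∧
    Integrable (fun z : ℂ => ‖u z‖ ^ 4) ∧
    Integrable (fun z : ℂ => ‖u z‖ ^ 2) ∧
    Integrable (fun z : ℂ => (‖z‖ ^ 2 - 1) * ‖u z‖ ^ 2) ∧
    Integrable (fun z : ℂ => z * ((‖u z‖ ^ 2 : ℝ) : ℂ)) ∧
    HasSum (fun n : ℕ => n.factorial * ‖α n‖ ^ 2) (mass u) ∧
    HasSum (fun n : ℕ => n * (n.factorial * ‖α n‖ ^ 2)) (angularMomentum u) ∧
    HasSum (fun n : ℕ => ((n + 1).factorial : ℂ) * (starRingEnd ℂ (α (n + 1)) * α n))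
      (magneticMomentum u) ∧
    HasSum (fun j : ℕ => (j.factorial : ℝ) / 2 ^ (j + 1) *
        ‖∑ k ∈ Finset.range (j + 1), α k * α (j - k)‖ ^ 2)
      (4 * Real.pi * hamiltonian u) := by
  obtain ⟨⟨f, hfd, huf⟩, hL2⟩ := hu
  have hf : Continuous f := hfd.continuous
  have hucont : Continuous u := by
    rw [funext huf]
    fun_prop
  obtain ⟨c, hc⟩ : ∃ c : ℕ → ℂ, ∀ z, HasSum (fun n => c n * z ^ n) (f z) :=
    ⟨fun n => (n.factorial : ℂ)⁻¹ * iteratedDeriv n f 0, fun z =>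
      (Complex.hasSum_taylorSeries_of_entire hfd 0 z).congr_fun fun n => by
        simp only [smul_eq_mul, sub_zero]; ring⟩
  have hnorm : ∀ z, ‖u z‖ = Real.exp (-‖z‖ ^ 2 / 2) * ‖f z‖ := fun z => by
    rw [huf, norm_mul, Complex.norm_real, Real.norm_of_nonneg (Real.exp_pos _).le]
  have hexp : ∀ z : ℂ, Real.exp (-‖z‖ ^ 2 / 2) ^ 2 = Real.exp (-1 * ‖z‖ ^ 2) := fun z => by
    rw [← Real.exp_nat_mul]; congr 1; push_cast; ring
  have hu2 : ∀ z, ‖u z‖ ^ 2 = ‖f z‖ ^ 2 * Real.exp (-1 * ‖z‖ ^ 2) := fun z => by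
    rw [hnorm, mul_pow, hexp, mul_comm]
  have hzu2 : ∀ z, ‖z‖ ^ 2 * ‖u z‖ ^ 2 = ‖z * f z‖ ^ 2 * Real.exp (-1 * ‖z‖ ^ 2) := fun z => by
    rw [hu2, norm_mul]; ring
  have hu4 : ∀ z, ‖u z‖ ^ 4 = ‖f z ^ 2‖ ^ 2 * Real.exp (-2 * ‖z‖ ^ 2) := fun z => by
    have : Real.exp (-2 * ‖z‖ ^ 2) = Real.exp (-1 * ‖z‖ ^ 2) ^ 2 := by
      rw [← Real.exp_nat_mul]; congr 1; push_cast; ring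
    rw [show ‖u z‖ ^ 4 = (‖u z‖ ^ 2) ^ 2 by ring, hu2, this, norm_pow]; ring
  have hI : Integrable fun z => (1 + ‖z‖ ^ 2) * ‖u z‖ ^ 2 := by
    have := (memLp_two_iff_integrable_sq_norm hL2.1).mp hL2
    refine this.congr (Filter.Eventually.of_forall fun z => ?_)
    simp only [norm_mul, Complex.norm_real, mul_pow, Real.norm_eq_abs, sq_abs]
    rw [Real.sq_sqrt (by positivity)]
  have hI2 : Integrable fun z => ‖u z‖ ^ 2 := by
    refine hI.mono' (by fun_prop : Continuous _).aestronglyMeasurable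
      (Filter.Eventually.of_forall fun z => ?_)
    rw [Real.norm_of_nonneg (by positivity)]
    nlinarith [mul_nonneg (sq_nonneg ‖z‖) (sq_nonneg ‖u z‖)]
  have hIz : Integrable fun z => ‖z‖ ^ 2 * ‖u z‖ ^ 2 := by
    refine hI.mono' (by fun_prop : Continuous _).aestronglyMeasurable
      (Filter.Eventually.of_forall fun z => ?_)
    rw [Real.norm_of_nonneg (by positivity)]
    nlinarith [sq_nonneg ‖u z‖]
  have hI2' : Integrable fun z => ‖f z‖ ^ 2 * Real.exp (-1 * ‖z‖ ^ 2) := by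
    simpa only [hu2] using hI2
  have hIz' : Integrable fun z => ‖z * f z‖ ^ 2 * Real.exp (-1 * ‖z‖ ^ 2) := by
    simpa only [hzu2] using hIz
  have hcz := hasSum_coeff_id_mul hc
  have hcs := hasSum_coeff_sq hc
  let α : ℕ → ℂ := fun n => Real.sqrt Real.pi * c n
  have hα2 : ∀ n, ‖α n‖ ^ 2 = Real.pi * ‖c n‖ ^ 2 := fun n => by
    simp only [α, norm_mul, Complex.norm_real, mul_pow, Real.norm_eq_abs, sq_abs]
    rw [Real.sq_sqrt Real.pi_pos.le]
  have hπ : ((Real.sqrt Real.pi : ℝ) : ℂ) * Real.sqrt Real.pi = Real.pi := by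
    exact_mod_cast Real.mul_self_sqrt Real.pi_pos.le
  have hM : HasSum (fun n : ℕ => n.factorial * ‖α n‖ ^ 2) (mass u) := by
    have := hasSum_integral_norm_sq_mul_gaussian one_pos hf hc hI2'
    simp only [← hu2] at this
    refine this.congr_fun fun n => ?_
    rw [hα2, one_pow]
    ring
  -- Multiplication by z shifts the coefficients, so n! becomes (n+1)!. Subtracting the mass later
  -- leaves the weight n of P.
  have hZ : HasSum (fun n : ℕ => (n + 1) * (n.factorial * ‖α n‖ ^ 2))
      (∫ z, ‖z‖ ^ 2 * ‖u z‖ ^ 2) := by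
    have := hasSum_integral_norm_sq_mul_gaussian one_pos (f := fun z => z * f z) (by fun_prop)
      hcz hIz'
    simp only [← hzu2] at this
    rw [← hasSum_nat_add_iff' 1] at this
    simp only [Finset.range_one, Finset.sum_singleton, if_true, norm_zero, ne_eq,
      OfNat.ofNat_ne_zero, not_false_eq_true, zero_pow, zero_mul, sub_zero] at this
    refine this.congr_fun fun n => ?_
    simp only [Nat.add_eq_zero_iff, one_ne_zero, and_false, if_false, Nat.add_sub_cancel, one_pow]
    rw [hα2, Nat.factorial_succ]
    push_cast
    ring
  -- Q is the pairing of f with z f.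
  have hQ := integrable_hasSum_conj_mul_gaussian one_pos hf (g := fun z => z * f z) (by fun_prop)
    hc hcz hI2' hIz'
  have hQe : ∀ z : ℂ, starRingEnd ℂ (f z) * (z * f z) * Real.exp (-1 * ‖z‖ ^ 2) =
      z * ((‖u z‖ ^ 2 : ℝ) : ℂ) := fun z => by
    rw [hu2, Complex.ofReal_mul, Complex.ofReal_pow, ← Complex.conj_mul']
    ring
  simp only [hQe] at hQ
  have hPs : Integrable fun z => (‖z‖ ^ 2 - 1) * ‖u z‖ ^ 2 :=
    (hIz.sub hI2).congr (Filter.Eventually.of_forall fun z => by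
      simp only [Pi.sub_apply]; ring)
  have hconv : ∀ j, ∑ k ∈ Finset.range (j + 1), α k * α (j - k) =
      Real.pi * ∑ k ∈ Finset.range (j + 1), c k * c (j - k) := fun j => by
    rw [Finset.mul_sum, ← hπ]
    exact Finset.sum_congr rfl fun k _ => by simp only [α]; ring
  have hterm : ∀ j : ℕ, ‖∑ k ∈ Finset.range (j + 1), c k * c (j - k)‖ ^ 2 *
      (Real.pi * j.factorial / 2 ^ (j + 1)) = Real.pi⁻¹ * ((j.factorial : ℝ) / 2 ^ (j + 1) *
        ‖∑ k ∈ Finset.range (j + 1), α k * α (j - k)‖ ^ 2) := fun j => by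
    rw [hconv, norm_mul, Complex.norm_real, mul_pow, Real.norm_eq_abs, sq_abs]
    have := Real.pi_pos.ne'
    field_simp
  -- Here summability comes first: |u|⁴ is |f²|² with the Gaussian of parameter 2, and its
  -- integrability is deduced from this series.
  have hsum : Summable fun j : ℕ => (j.factorial : ℝ) / 2 ^ (j + 1) *
        ‖∑ k ∈ Finset.range (j + 1), α k * α (j - k)‖ ^ 2 := by
    have hMM := hasSum_sum_range_mul hM hM hM.summable.norm hM.summable.norm
    refine Summable.of_nonneg_of_le (fun j => by positivity) (fun j => ?_) hMM.summable
    have h := norm_sum_conv_sq_le α j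
    have h0 : 0 ≤ ∑ k ∈ Finset.range (j + 1),
        (k.factorial * ‖α k‖ ^ 2) * ((j - k).factorial * ‖α (j - k)‖ ^ 2) :=
      Finset.sum_nonneg fun k _ => by positivity
    have h1 : (2 : ℝ) ^ j ≤ 2 ^ (j + 1) := pow_le_pow_right₀ one_le_two (Nat.le_succ j)
    rw [div_mul_eq_mul_div, div_le_iff₀ (by positivity)]
    linarith [mul_le_mul_of_nonneg_right h1 h0]
  have hI4' := integrable_norm_sq_mul_gaussian two_pos (hf.pow 2) hcs (by
    simp only [hterm]
    exact hsum.mul_left _)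
  have hH := hasSum_integral_norm_sq_mul_gaussian two_pos (hf.pow 2) hcs hI4'
  simp only [hterm, Pi.pow_apply, ← hu4] at hH hI4'
  refine ⟨α, fun n => coeff_eq_of_hasSum hf huf hc hI2' n, hI4', hI2, hPs, hQ.1, hM, ?_, ?_, ?_⟩
  · have hP : angularMomentum u = (∫ z, ‖z‖ ^ 2 * ‖u z‖ ^ 2) - mass u := by
      rw [angularMomentum, mass, ← integral_sub hIz hI2]
      congr 1
      funext z
      ring
    rw [hP]
    refine (hZ.sub hM).congr_fun fun n => ?_
    ring
  · have h := hQ.2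
    rw [← hasSum_nat_add_iff' 1] at h
    simp only [Finset.range_one, Finset.sum_singleton, if_true, mul_zero, zero_mul,
      sub_zero] at h
    refine h.congr_fun fun n => ?_
    simp only [Nat.add_eq_zero_iff, one_ne_zero, and_false, if_false, Nat.add_sub_cancel, α,
      map_mul, Complex.conj_ofReal, Complex.ofReal_one, one_pow, div_one]
    rw [← hπ]
    ring
  · have h := hH.mul_left Real.pi
    have e : 4 * Real.pi * hamiltonian u = Real.pi * ∫ z, ‖u z‖ ^ 4 := by
      rw [hamiltonian]; ring
    rw [e]
    refine h.congr_fun fun n => ?_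
    rw [mul_inv_cancel_left₀ Real.pi_pos.ne']


/-! ### Assembling B(u) degree by degree. -/

theorem varA_eq_conv {a α : ℕ → ℂ} (h : ∀ n, a n = Real.sqrt n.factorial * α n) (j : ℕ) :
    varA a j = fun k : Fin (j + 1) => α k * α (j - k) := by
  funext k
  rw [varA, h, h, Real.sqrt_mul (Nat.cast_nonneg _)]
  have h1 : ∀ n : ℕ, ((Real.sqrt n.factorial : ℝ) : ℂ) ≠ 0 := fun n => by
    exact_mod_cast (Real.sqrt_pos.mpr (by exact_mod_cast n.factorial_pos)).ne'
  have h2 := h1 k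
  have h3 := h1 (j - k)
  push_cast
  field_simp

theorem isSymmVec_conv (α : ℕ → ℂ) (j : ℕ) :
    IsSymmVec fun k : Fin (j + 1) => α k * α (j - k) := by
  intro k
  have hk : (k : ℕ) ≤ j := by omega
  have h1 : ((k.rev : Fin (j + 1)) : ℕ) = j - k := by rw [Fin.val_rev]; omega
  simp only [h1, Nat.sub_sub_self hk]
  ring

theorem hasSum_hermForm_conv {α : ℕ → ℂ} {m p h : ℝ} {q : ℂ}
    (hm : HasSum (fun n : ℕ => n.factorial * ‖α n‖ ^ 2) m)
    (hp : HasSum (fun n : ℕ => n * (n.factorial * ‖α n‖ ^ 2)) p)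
    (hq : HasSum (fun n : ℕ => ((n + 1).factorial : ℂ) * (starRingEnd ℂ (α (n + 1)) * α n)) q)
    (hh : HasSum (fun j : ℕ => (j.factorial : ℝ) / 2 ^ (j + 1) *
        ‖∑ k ∈ Finset.range (j + 1), α k * α (j - k)‖ ^ 2) h) :
    HasSum (fun j => hermForm (blockB j) fun k => α k * α (j - k))
      ((h + 1 / 4 * (m * p - ‖q‖ ^ 2) - 1 / 2 * m ^ 2 : ℝ) : ℂ) := by
  have hmm := hasSum_sum_range_mul hm hm hm.summable.norm hm.summable.norm
  have hpm := hasSum_sum_range_mul hp hm hp.summable.norm hm.summable.norm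
  have hmp := hasSum_sum_range_mul hm hp hm.summable.norm hp.summable.norm
  have hq' : HasSum (fun n : ℕ => ((n + 1).factorial : ℂ) * (α (n + 1) * starRingEnd ℂ (α n)))
      (starRingEnd ℂ q) := by
    refine (Complex.hasSum_conj'.mpr hq).congr_fun fun n => ?_
    simp
  have hqq := (hasSum_sum_range_mul hq hq' hq.summable.norm hq'.summable.norm).add
    (hasSum_sum_range_mul hq' hq hq'.summable.norm hq.summable.norm)
  -- Degree j of the Cauchy product of Q and its conjugate pairs neighbouring entries of block j+1,
  -- and block 0 has none. Both orders are added to obtain a Hermitian expression, so |Q|² is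
  -- counted twice and 1/4 becomes 1/8.
  have hshift : HasSum (fun j : ℕ => ∑ k ∈ Finset.range j,
      ((k + 1).factorial * (j - k).factorial : ℂ) *
        (starRingEnd ℂ (α k * α (j - k)) * (α (k + 1) * α (j - (k + 1))) +
          starRingEnd ℂ (α (k + 1) * α (j - (k + 1))) * (α k * α (j - k))))
      (q * starRingEnd ℂ q + starRingEnd ℂ q * q) := by
    rw [← hasSum_nat_add_iff' 1]
    simp only [Finset.range_one, Finset.sum_singleton, Finset.range_zero, Finset.sum_empty,
      sub_zero]
    refine hqq.congr_fun fun j => ?_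
    rw [← Finset.sum_add_distrib]
    refine Finset.sum_congr rfl fun k hk => ?_
    have hk' : k ≤ j := by simpa [Nat.lt_succ_iff] using hk
    rw [show j + 1 - (k + 1) = j - k by omega, show j + 1 - k = j - k + 1 by omega]
    simp only [map_mul]
    ring
  have hdiag : HasSum (fun j : ℕ => (((j : ℝ) - 4) / 8 * ∑ k ∈ Finset.range (j + 1),
      (k.factorial * ‖α k‖ ^ 2) * ((j - k).factorial * ‖α (j - k)‖ ^ 2)))
      (1 / 4 * (m * p) - 1 / 2 * m ^ 2) := by
    -- Symmetrizing MP adds the weights k and j-k to j, while M² contributes the -4.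
    have := ((hpm.add hmp).sub (hmm.mul_left 4)).mul_left (1 / 8)
    rw [show 1 / 4 * (m * p) - 1 / 2 * m ^ 2 = 1 / 8 * (p * m + m * p - 4 * (m * m)) by ring]
    refine this.congr_fun fun j => ?_
    rw [← Finset.sum_add_distrib, Finset.mul_sum, Finset.mul_sum, ← Finset.sum_sub_distrib,
      Finset.mul_sum]
    refine Finset.sum_congr rfl fun k hk => ?_
    have hk' : k ≤ j := by simpa [Nat.lt_succ_iff] using hk
    rw [Nat.cast_sub hk']
    ring
  have hall := ((Complex.hasSum_ofReal.mpr hh).add (Complex.hasSum_ofReal.mpr hdiag)).sub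
    (hshift.mul_left (1 / 8))
  have hval : ((h + 1 / 4 * (m * p - ‖q‖ ^ 2) - 1 / 2 * m ^ 2 : ℝ) : ℂ) =
      (h : ℂ) + ((1 / 4 * (m * p) - 1 / 2 * m ^ 2 : ℝ) : ℂ) -
        1 / 8 * (q * starRingEnd ℂ q + starRingEnd ℂ q * q) := by
    push_cast
    rw [← Complex.conj_mul']
    ring
  rw [hval]
  refine hall.congr_fun fun j => ?_
  rw [hermForm_blockB_eq j fun k => α k * α (j - k)]
  push_cast
  simp only [← Complex.conj_mul']
  congr 3
  refine Finset.sum_congr rfl fun k _ => ?_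
  rw [map_mul]
  ring

theorem functionalB_const_mul (u : ℂ → ℂ) (c : ℂ) :
    functionalB (fun z => c * u z) = ‖c‖ ^ 4 * functionalB u := by
  have h1 : hamiltonian (fun z => c * u z) = ‖c‖ ^ 4 * hamiltonian u := by
    simp only [hamiltonian, norm_mul, mul_pow, integral_const_mul]
    ring
  have h2 : mass (fun z => c * u z) = ‖c‖ ^ 2 * mass u := by
    simp only [mass, norm_mul, mul_pow, integral_const_mul]
  have h3 : angularMomentum (fun z => c * u z) = ‖c‖ ^ 2 * angularMomentum u := by
    simp only [angularMomentum, norm_mul, mul_pow, mul_left_comm _ (‖c‖ ^ 2), integral_const_mul]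
  have h4 : magneticMomentum (fun z => c * u z) =
      ((‖c‖ ^ 2 : ℝ) : ℂ) * magneticMomentum u := by
    simp only [magneticMomentum, norm_mul, mul_pow, Complex.ofReal_mul,
      mul_left_comm _ (((‖c‖ ^ 2 : ℝ)) : ℂ), integral_const_mul]
  rw [functionalB, functionalB, h1, h2, h3, h4, norm_mul, Complex.norm_real,
    Real.norm_of_nonneg (by positivity)]
  ring

theorem hasSum_hermForm_functionalB {u : ℂ → ℂ} (hu : u ∈ L21E) :
    HasSum (fun j : ℕ => hermForm (blockB j) (varA (coeff u) j)) (functionalB u : ℂ) := by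
  obtain ⟨α, hα, -, -, -, -, hm, hp, hq, hh⟩ := exists_coeff_hasSum hu
  simp only [varA_eq_conv hα]
  exact hasSum_hermForm_conv hm hp hq hh

theorem isSymmVec_varA (a : ℕ → ℂ) (j : ℕ) : IsSymmVec (varA a j) := by
  have h : ∀ n, a n = Real.sqrt n.factorial * (a n / Real.sqrt n.factorial) := fun n => by
    rw [mul_div_cancel₀]
    exact_mod_cast (Real.sqrt_pos.mpr (by exact_mod_cast n.factorial_pos)).ne'
  rw [varA_eq_conv h]
  exact isSymmVec_conv (fun n => a n / Real.sqrt n.factorial) j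

theorem functionalB_nonneg {u : ℂ → ℂ} (hu : u ∈ L21E) : 0 ≤ functionalB u :=
  (Complex.hasSum_re (hasSum_hermForm_functionalB hu)).nonneg fun j =>
    (hermForm_blockB_nonneg j _ (isSymmVec_varA _ j)).1

end LLL

theorem theorem1p2 :
    -- `B` is well defined, homogeneous and non-negative on `L^{2,1}_𝓔`
    (∀ u ∈ LLL.L21E,
      MeasureTheory.Integrable (fun z : ℂ => ‖u z‖ ^ 4) ∧
      MeasureTheory.Integrable (fun z : ℂ => ‖u z‖ ^ 2) ∧
      MeasureTheory.Integrable (fun z : ℂ => (‖z‖ ^ 2 - 1) * ‖u z‖ ^ 2) ∧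
      MeasureTheory.Integrable (fun z : ℂ => z * ((‖u z‖ ^ 2 : ℝ) : ℂ)) ∧
      (∀ c : ℂ, LLL.functionalB (fun z => c * u z) = ‖c‖ ^ 4 * LLL.functionalB u) ∧
      0 ≤ LLL.functionalB u) ∧
    -- `B` is the quadratic form with blocks `B^{(j)}` in the variables `A_{jk}`
    (∀ u ∈ LLL.L21E,
      (∀ j : ℕ, LLL.IsSymmVec (LLL.varA (LLL.coeff u) j)) ∧
      HasSum (fun j : ℕ => LLL.hermForm (LLL.blockB j) (LLL.varA (LLL.coeff u) j))
        (LLL.functionalB u : ℂ)) ∧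
    -- each block is real symmetric and positive semidefinite on symmetric vectors
    (∀ j : ℕ, (LLL.blockB j).IsSymm ∧
      ∀ v : Fin (j + 1) → ℂ, LLL.IsSymmVec v →
        0 ≤ (LLL.hermForm (LLL.blockB j) v).re ∧ (LLL.hermForm (LLL.blockB j) v).im = 0) := by
  refine ⟨fun u hu => ?_, fun u hu => ⟨LLL.isSymmVec_varA _, LLL.hasSum_hermForm_functionalB hu⟩,
    fun j => ⟨LLL.blockB_isSymm j, LLL.hermForm_blockB_nonneg j⟩⟩
  obtain ⟨-, -, h4, h2, hp, hq, -⟩ := LLL.exists_coeff_hasSum hu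
  exact ⟨h4, h2, hp, hq, LLL.functionalB_const_mul u, LLL.functionalB_nonneg hu⟩
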